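/- BACO on Sorting with the Final-Position-Prefix objective is the following randomized algorithm. Let $n$ pairwise distinct keys $0,1,\dots,n-1$ be given, named by their ranks, and let $\tau_{\min},\tau_{\max}>0$ be two pheromone levels with pheromone ratio $t=\tau_{\min}/\tau_{\max}>0$. The construction graph is the directed graph with a starting vertex $v_{\text{start}}$ and one vertex per key, with an edge from $v_{\text{start}}$ to every key and an edge between any two distinct keys in both directions. The ant starts in $v_{\text{start}}$ and builds a Hamiltonian path step by step: from its current vertex $u$ it moves to an unvisited key $v$ with probability $\tau(u,v)/\sum_{w\text{ unvisited}}\tau(u,w)$, where $\tau$ denotes the current pheromone values. A path is identified with the order $\pi$ in which it visits the keys; its objective value $\mathrm{FPP}(\pi)\in\{0,\dots,n\}$ is the number of leading keys that are in the same position as in the sorted list. First the ant constructs an initial best path $\pi^*$ with all pheromones equal to $\tau_{\min}$. From then on, the edges of the current best path $\pi^*$ carry pheromone $\tau_{\max}$ and all other edges carry $\tau_{\min}$. In each iteration the ant constructs a path $\pi$, and $\pi^*$ is replaced by $\pi$ (and the pheromones are updated accordingly) if $\mathrm{FPP}(\pi)>\mathrm{FPP}(\pi^*)$. The algorithm stops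 as soon as $\mathrm{FPP}(\pi^*)=n$. Let $T(n,t)$ be the expected number of iterations (the construction of the initial path is not counted). Theorem. For all $n$ and all $t>0$ the expected optimization time $T(n,t)$ is finite, and the following holds as $n\to\infty$, where $t=t(n)>0$ may depend on $n$ and $c>0$ and $s\in\mathbb{R}$ are constants. 1. $T(n,t)\in\Omega(n^3)$ for every $t=t(n)>0$; that is, there are $C>0$ and $N$ such that $T(n,t)\ge C n^3$ for all $n\ge N$ and all $t>0$. 2. If $t\in O(1/n^2)$, then $T(n,t)\in\Theta(n/t)$. 3. If $t=c/n^s$ with $s\ge 2$, then $T(n,t)\in\Theta(n^{s+1})$. In particular, $T(n,t)\in\Theta(n^3)$ for $t=c/n^2$. 4. If $t=c/n^s$ with $s<2$, then $T(n,t)\in O\bigl(n^{s+1}\cdot e^{c\,n^{2-s}}\bigr)$. 5. If $t=1$ (blind search), then $T(n,t)\in\Theta(n!)$. -/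

import Mathlib

open scoped ENNReal
open Filter Asymptotics

namespace BACO

/-- Positive real numbers; pheromone values live here. -/
abbrev PosReal : Type := {x : ℝ // 0 < x}

/-! ### Construction graph, pheromones and the random walk of the ant

There are `n` pairwise distinct keys, identified with their ranks: the key `i : Fin n` is the one
that stands at position `i` (counted from `0`) of the sorted list.  The algorithm only uses the
objective function, so this naming of the keys is no loss of generality.
The vertices of the construction graph are the elements of `Option (Fin n)`: the starting vertex is
`none`, and the vertex of the key `i` is `some i`.  No edge enters the starting vertex, so the
target of an edge is a key.  A path is recorded as the list of the keys in the order in which they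
are visited (the starting vertex is omitted). -/

/-- A path of the ant, that is, an ordering of the keys. -/
abbrev Path (n : ℕ) : Type := List (Fin n)

instance instMeasurableSpacePath (n : ℕ) : MeasurableSpace (Path n) := ⊤

/-- A pheromone value for every edge of the construction graph. -/
abbrev Pheromones (n : ℕ) : Type := Option (Fin n) → Fin n → PosReal

theorem tsum_weights_ne_zero {n : ℕ} (w : Fin n → PosReal) (S : Finset (Fin n))
    (hS : S.Nonempty) :
    (∑' v, if v ∈ S then ENNReal.ofReal (w v : ℝ) else 0) ≠ 0 := by
  obtain ⟨v, hv⟩ := hS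
  intro h
  have h0 := ENNReal.tsum_eq_zero.1 h v
  rw [if_pos hv, ENNReal.ofReal_eq_zero] at h0
  exact absurd (w v).2 (not_lt.2 h0)

theorem tsum_weights_ne_top {n : ℕ} (w : Fin n → PosReal) (S : Finset (Fin n)) :
    (∑' v, if v ∈ S then ENNReal.ofReal (w v : ℝ) else 0) ≠ ∞ := by
  rw [tsum_fintype]
  refine ENNReal.sum_ne_top.2 fun v _ => ?_
  split_ifs
  · exact ENNReal.ofReal_ne_top
  · exact ENNReal.zero_ne_top

/-- One step of the ant from the vertex `u` when `S` is the non-empty set of keys not visited yet: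
the key `v ∈ S` is chosen with probability `τ u v / ∑ w ∈ S, τ u w`. -/
noncomputable def nextKey {n : ℕ} (τ : Pheromones n) (u : Option (Fin n)) (S : Finset (Fin n))
    (hS : S.Nonempty) : PMF (Fin n) :=
  PMF.normalize (fun v => if v ∈ S then ENNReal.ofReal (τ u v : ℝ) else 0)
    (tsum_weights_ne_zero (τ u) S hS) (tsum_weights_ne_top (τ u) S)

/-- The law of the next `m` steps of the ant from the vertex `u` when `S` is the set of keys not
visited yet. -/
noncomputable def walkFrom {n : ℕ} (τ : Pheromones n) :
    ℕ → Option (Fin n) → Finset (Fin n) → PMF (Path n)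
  | 0, _, _ => PMF.pure []
  | m + 1, u, S =>
    if hS : S.Nonempty then
      (nextKey τ u S hS).bind fun v => (walkFrom τ m (some v) (S.erase v)).map (fun l => v :: l)
    else PMF.pure []

/-- The law of the Hamiltonian path constructed by the ant from the starting vertex. -/
noncomputable def walk {n : ℕ} (τ : Pheromones n) : PMF (Path n) :=
  walkFrom τ n none Finset.univ

/-- The directed edge from `u` to `v` is used by the path `π` (which begins in the starting
vertex). -/
def UsesEdge {n : ℕ} (π : Path n) (u : Option (Fin n)) (v : Fin n) : Prop :=
  [u, some v] <:+: none :: π.map some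

open Classical in
/-- The pheromones after an update with best path `π`: every edge of `π` carries `τmax`, every other
edge carries `τmin`. -/
noncomputable def updatedPheromones {n : ℕ} (τmin τmax : PosReal) (π : Path n) : Pheromones n :=
  fun u v => if UsesEdge π u v then τmax else τmin

/-! ### The objective function -/

/-- Final Position Prefix: the number of leading keys of `π` that are in the same position as in the
sorted list `0, 1, …, n - 1`. -/
def fpp {n : ℕ} (π : Path n) : ℕ :=
  ((π.zip (List.finRange n)).takeWhile (fun p => decide (p.1 = p.2))).length

/-! ### The algorithm -/

/-- The law of the initial best path: all pheromones are `τmin`. -/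
noncomputable def initialLaw (n : ℕ) (τmin : PosReal) : PMF (Path n) :=
  walk (fun _ _ => τmin)

/-- One iteration with current best path `best`: the ant constructs a path with the pheromones given
by `best`, and this path replaces `best` if it is strictly better. -/
noncomputable def iteration {n : ℕ} (τmin τmax : PosReal) (best : Path n) : PMF (Path n) :=
  (walk (updatedPheromones τmin τmax best)).map
    (fun π => if fpp best < fpp π then π else best)

noncomputable def iterationKernel (n : ℕ) (τmin τmax : PosReal) :
    ProbabilityTheory.Kernel (Path n) (Path n) :=
  ProbabilityTheory.Kernel.ofFunOfCountable
    (fun best => (iteration τmin τmax best).toMeasure)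

instance instIsMarkovKernelIterationKernel (n : ℕ) (τmin τmax : PosReal) :
    ProbabilityTheory.IsMarkovKernel (iterationKernel n τmin τmax) :=
  ⟨fun best => PMF.toMeasure.isProbabilityMeasure (iteration τmin τmax best)⟩

/-- The law of the sequence of best paths: `ω 0` is the initial best path and `ω k` is the best path
after `k` iterations. -/
noncomputable def processLaw (n : ℕ) (τmin τmax : PosReal) : MeasureTheory.Measure (ℕ → Path n) :=
  ProbabilityTheory.Kernel.trajMeasure (X := fun _ => Path n)
    (initialLaw n τmin).toMeasure
    (fun k => (iterationKernel n τmin τmax).comap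
      (fun h : (i : Finset.Iic k) → Path n => h ⟨k, Finset.mem_Iic.2 le_rfl⟩)
      (measurable_pi_apply _))

/-- The number of iterations until the best path is optimal (`∞` if this never happens). -/
noncomputable def optimizationTime {n : ℕ} (ω : ℕ → Path n) : ℝ≥0∞ :=
  ⨅ (k : ℕ) (_ : fpp (ω k) = n), (k : ℝ≥0∞)

/-- The expected optimization time. -/
noncomputable def expectedTime (n : ℕ) (τmin τmax : PosReal) : ℝ≥0∞ :=
  ∫⁻ ω, optimizationTime ω ∂(processLaw n τmin τmax)

/-- The expected optimization time as a real number (meaningful when `expectedTime` is finite). -/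
noncomputable def T (n : ℕ) (τmin τmax : PosReal) : ℝ :=
  (expectedTime n τmin τmax).toReal

/-- The pheromone ratio. -/
noncomputable def ratio (τmin τmax : PosReal) : ℝ := (τmin : ℝ) / (τmax : ℝ)

end BACO

namespace BACO

/-! ### The objective function -/

/-! Let the best path have value `k < n`. To improve it, the ant must repeat the `k` correct keys,
each along a `τmax` edge, and then take key `k` along a `τmin` edge. When `j` keys have been
visited, exactly one of the `n - j` available edges carries `τmax`. The success probability is
therefore a product depending only on `k` and the ratio `t`, and `levelCost` is its reciprocal
(`walk_improvement`).

The time spent at value `k` is geometric with mean `levelCost`, provided that value is ever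
attained, so its expectation is at most `levelCost` (`levelTime_le`). For `k ≤ n - 2` it is at least
half of that (`le_levelTime`). Indeed, permuting the keys that are at least `k` leaves the process
below value `k` unchanged in law, and swapping `k` with `k + 1` turns a path of value above `k` into
one of value exactly `k`. Hence value `k` is skipped with probability at most 1/2. The value `n - 1`
never occurs for a permutation.

Up to a factor 2 and the last summand, `T` is thus the sum of the level costs, and all the
asymptotics are estimates of this explicit sum (`T_le`, `le_T`). -/

theorem le_length_takeWhile_zip {α : Type*} [DecidableEq α] (a b : List α) (k : ℕ) :
    k ≤ ((a.zip b).takeWhile (fun p => decide (p.1 = p.2))).length ↔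
      k ≤ b.length ∧ b.take k <+: a := by
  induction k generalizing a b with
  | zero => simp
  | succ k ih =>
    rcases a with _ | ⟨x, a⟩
    · rcases b with _ | ⟨y, b⟩ <;> simp
    rcases b with _ | ⟨y, b⟩
    · simp
    by_cases h : x = y
    · subst h
      simp [ih a b, List.cons_prefix_cons]
    · simp [h, List.cons_prefix_cons, Ne.symm h]

theorem fpp_le {n : ℕ} (π : Path n) : fpp π ≤ n := by
  have := (le_length_takeWhile_zip π (List.finRange n) (fpp π)).1 le_rfl
  simpa using this.1

theorem le_fpp_iff_prefix {n : ℕ} (π : Path n) {k : ℕ} (hk : k ≤ n) :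
    k ≤ fpp π ↔ (List.finRange n).take k <+: π := by
  unfold fpp
  rw [le_length_takeWhile_zip]
  simp [hk]

theorem le_fpp_iff {n : ℕ} (π : Path n) {k : ℕ} (hk : k ≤ n) :
    k ≤ fpp π ↔ ∀ i : Fin n, (i : ℕ) < k → π[(i : ℕ)]? = some i := by
  rw [le_fpp_iff_prefix π hk, List.prefix_iff_getElem?]
  simp only [List.length_take, List.length_finRange, lt_min_iff, List.getElem_take,
    List.getElem_finRange]
  constructor
  · intro h i hi
    simpa using h i ⟨hi, i.2⟩
  · intro h i hi
    simpa using h ⟨i, hi.2⟩ hi.1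

theorem le_fpp_map_iff {n : ℕ} (σ : Equiv.Perm (Fin n)) {k : ℕ}
    (hσ : ∀ i : Fin n, (i : ℕ) < k → σ i = i) (π : Path n) {j : ℕ} (hjk : j ≤ k) (hj : j ≤ n) :
    j ≤ fpp (π.map σ) ↔ j ≤ fpp π := by
  rw [le_fpp_iff _ hj, le_fpp_iff _ hj]
  refine forall₂_congr fun i hi => ?_
  have hi' := hσ i (by omega)
  rw [List.getElem?_map, Option.map_eq_some_iff]
  constructor
  · rintro ⟨a, ha, hai⟩
    rw [ha]
    exact congrArg some (σ.injective (hai.trans hi'.symm))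
  · intro h
    exact ⟨i, h, hi'⟩

/-! ### Tours -/

/-- The keys are visited exactly once each. -/
def IsTour {n : ℕ} (π : Path n) : Prop := π.Nodup ∧ ∀ v, v ∈ π

theorem IsTour.length_eq {n : ℕ} {π : Path n} (h : IsTour π) : π.length = n := by
  rw [← List.toFinset_card_of_nodup h.1, show π.toFinset = Finset.univ by ext v; simp [h.2 v]]
  simp

/-- No vertex repeats, so each has at most one successor. The starting vertex shifts indices by one:
the successor of vertex number `i` is the key `π[i]`. -/
theorem usesEdge_iff {n : ℕ} {π : Path n} (hπ : π.Nodup) {i : ℕ} {u : Option (Fin n)} {x : Fin n}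
    (hu : (none :: π.map some)[i]? = some u) (hx : π[i]? = some x) (v : Fin n) :
    UsesEdge π u v ↔ v = x := by
  unfold UsesEdge
  set l : List (Option (Fin n)) := none :: π.map some with hl
  have hnd : l.Nodup := by
    rw [hl, List.nodup_cons]
    exact ⟨by simp, hπ.map (Option.some_injective _)⟩
  have hx' : l[i + 1]? = some (some x) := by simp [hl, hx]
  obtain ⟨hi1, hx1⟩ := List.getElem?_eq_some_iff.1 hx'
  obtain ⟨hi0, hu1⟩ := List.getElem?_eq_some_iff.1 hu
  constructor
  · rintro ⟨s, t, hst⟩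
    have h1 : l[s.length]? = some u := by rw [← hst]; simp
    have h2 : l[s.length + 1]? = some (some v) := by
      rw [← hst]
      simp
    obtain ⟨hs, hs'⟩ := List.getElem?_eq_some_iff.1 h1
    have : s.length = i := (hnd.getElem_inj_iff).1 (hs'.trans hu1.symm)
    rw [this, hx'] at h2
    simpa using h2.symm
  · rintro rfl
    refine ⟨l.take i, l.drop (i + 2), ?_⟩
    conv_rhs => rw [← List.take_append_drop i l]
    rw [List.drop_eq_getElem_cons hi0, List.drop_eq_getElem_cons hi1, hu1, hx1]
    simp

/-! ### The walk of the ant -/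

theorem nextKey_apply {n : ℕ} (τ : Pheromones n) (u : Option (Fin n)) (S : Finset (Fin n))
    (hS : S.Nonempty) (v : Fin n) :
    nextKey τ u S hS v =
      if v ∈ S then ENNReal.ofReal ((τ u v : ℝ) / ∑ w ∈ S, (τ u w : ℝ)) else 0 := by
  unfold nextKey
  rw [PMF.normalize_apply]
  split_ifs with hv
  · have hpos : 0 < ∑ w ∈ S, (τ u w : ℝ) := Finset.sum_pos (fun w _ => (τ u w).2) hS
    rw [ENNReal.ofReal_div_of_pos hpos, ENNReal.ofReal_sum_of_nonneg (fun w _ => (τ u w).2.le),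
      tsum_fintype, ← Finset.sum_filter, div_eq_mul_inv]
    simp
  · simp

theorem walkFrom_succ {n : ℕ} (τ : Pheromones n) (m : ℕ) (u : Option (Fin n)) {S : Finset (Fin n)}
    (hS : S.Nonempty) :
    walkFrom τ (m + 1) u S = (nextKey τ u S hS).bind fun v =>
      (walkFrom τ m (some v) (S.erase v)).map (fun l => v :: l) := by
  rw [walkFrom, dif_pos hS]

/-- Chain rule: only the branch whose first step is `j` contributes. -/
theorem walkFrom_cons_prefix {n : ℕ} (τ : Pheromones n) (m : ℕ) (u : Option (Fin n))
    {S : Finset (Fin n)} (hS : S.Nonempty) (j : Fin n) (l : Path n) :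
    (walkFrom τ (m + 1) u S).toOuterMeasure {π | j :: l <+: π} =
      nextKey τ u S hS j *
        (walkFrom τ m (some j) (S.erase j)).toOuterMeasure {π | l <+: π} := by
  rw [walkFrom_succ τ m u hS, PMF.toOuterMeasure_bind_apply, tsum_eq_single j]
  · congr 1
    rw [PMF.toOuterMeasure_map_apply]
    congr 1
    ext π
    simp [List.cons_prefix_cons]
  · intro v hv
    rw [PMF.toOuterMeasure_map_apply]
    have : (fun l => v :: l) ⁻¹' {π : Path n | j :: l <+: π} = ∅ := by
      ext π
      simp [List.cons_prefix_cons, Ne.symm hv]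
    rw [this]
    simp

theorem mem_support_walkFrom {n : ℕ} (τ : Pheromones n) (m : ℕ) (u : Option (Fin n))
    (S : Finset (Fin n)) (hm : S.card = m) {π : Path n}
    (hπ : π ∈ (walkFrom τ m u S).support) : π.Nodup ∧ ∀ v, v ∈ π ↔ v ∈ S := by
  induction m generalizing u S π with
  | zero =>
    rw [Finset.card_eq_zero] at hm
    subst hm
    simp only [walkFrom, PMF.support_pure, Set.mem_singleton_iff] at hπ
    simp [hπ]
  | succ m ih =>
    have hS : S.Nonempty := Finset.card_pos.1 (by omega)
    rw [walkFrom_succ τ m u hS, PMF.mem_support_bind_iff] at hπ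
    obtain ⟨v, hv, hπ⟩ := hπ
    rw [PMF.mem_support_map_iff] at hπ
    obtain ⟨l, hl, rfl⟩ := hπ
    have hvS : v ∈ S := by
      rw [PMF.mem_support_iff, nextKey_apply] at hv
      by_contra h
      simp [h] at hv
    obtain ⟨h1, h2⟩ := ih (some v) (S.erase v) (by rw [Finset.card_erase_of_mem hvS]; omega) hl
    refine ⟨List.nodup_cons.2 ⟨by simp [h2], h1⟩, fun w => ?_⟩
    rw [List.mem_cons, h2, Finset.mem_erase]
    by_cases hw : w = v
    · simp [hw, hvS]
    · simp [hw]

theorem isTour_of_mem_support_walk {n : ℕ} (τ : Pheromones n) {π : Path n}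
    (hπ : π ∈ (walk τ).support) : IsTour π := by
  have := mem_support_walkFrom τ n none Finset.univ (by simp) hπ
  exact ⟨this.1, fun v => by simp [this.2 v]⟩

/-! ### The probability of an improvement -/

/-- The reciprocal of the probability that the next path improves a best path of value `k`, as a
function of the pheromone ratio `t`. -/
noncomputable def levelCost (n : ℕ) (t : ℝ) (k : ℕ) : ℝ :=
  1 / t * ∏ j ∈ Finset.range (k + 1), (1 + ((n : ℝ) - 1 - j) * t)

theorem ratio_pos (a b : PosReal) : 0 < ratio a b := div_pos a.2 b.2

theorem levelCost_factor_pos {n j : ℕ} {t : ℝ} (ht : 0 < t) (hj : j < n) :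
    0 < 1 + ((n : ℝ) - 1 - j) * t := by
  have : (j : ℝ) + 1 ≤ n := by exact_mod_cast hj
  have : 0 ≤ ((n : ℝ) - 1 - j) * t := mul_nonneg (by linarith) ht.le
  linarith

theorem levelCost_pos {n k : ℕ} {t : ℝ} (ht : 0 < t) (hk : k < n) : 0 < levelCost n t k := by
  refine mul_pos (one_div_pos.2 ht) (Finset.prod_pos fun j hj => ?_)
  exact levelCost_factor_pos ht (by rw [Finset.mem_range] at hj; omega)

theorem sum_updatedPheromones {n : ℕ} (a b : PosReal) {π : Path n} (hπ : IsTour π) {i : ℕ}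
    {u : Option (Fin n)} {x : Fin n} (hu : (none :: π.map some)[i]? = some u)
    (hx : π[i]? = some x) (S : Finset (Fin n)) (hxS : x ∈ S) :
    ∑ w ∈ S, (updatedPheromones a b π u w : ℝ) = b + ((S.card : ℝ) - 1) * a := by
  have hw : ∀ w, (updatedPheromones a b π u w : ℝ) = if w = x then (b : ℝ) else a := by
    intro w
    unfold updatedPheromones
    simp only [usesEdge_iff hπ.1 hu hx w]
    split_ifs <;> rfl
  rw [← Finset.add_sum_erase _ _ hxS, hw x, if_pos rfl,
    Finset.sum_congr rfl (g := fun _ => (a : ℝ))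
      (fun w hw' => by rw [hw, if_neg (Finset.ne_of_mem_erase hw')]),
    Finset.sum_const, Finset.card_erase_of_mem hxS, nsmul_eq_mul,
    Nat.cast_sub (Finset.card_pos.2 ⟨x, hxS⟩)]
  simp

/-- The successor of `u` in `π` is always unvisited, so the normaliser has the same form for `i < k`
and `i = k`. The edge to key `i` carries `τmax` if `i < k`. It carries `τmin` if `i = k`, since
otherwise `π` would have value above `k`. -/
theorem walkFrom_updated_step {n : ℕ} (a b : PosReal) {π : Path n} (hπ : IsTour π) {k : ℕ}
    (hk : k < n) (hf : fpp π = k) {i : ℕ} (hik : i ≤ k) {u : Option (Fin n)}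
    (hu : (none :: π.map some)[i]? = some u) :
    (walkFrom (updatedPheromones a b π) (n - i) u
        (Finset.univ.filter fun j : Fin n => i ≤ (j : ℕ))).toOuterMeasure
      {ρ | ((List.finRange n).take (k + 1)).drop i <+: ρ} =
      ENNReal.ofReal ((if i < k then 1 else ratio a b) /
        (1 + ((n : ℝ) - 1 - i) * ratio a b)) *
      (walkFrom (updatedPheromones a b π) (n - (i + 1)) (some ⟨i, by omega⟩)
        (Finset.univ.filter fun j : Fin n => i + 1 ≤ (j : ℕ))).toOuterMeasure
      {ρ | ((List.finRange n).take (k + 1)).drop (i + 1) <+: ρ} := by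
  have hpre := (le_fpp_iff π hk.le).1 hf.ge
  have hin : i < n := by omega
  have ha := a.2
  have hb := b.2
  set S := Finset.univ.filter fun j : Fin n => i ≤ (j : ℕ) with hS
  have hiS : (⟨i, hin⟩ : Fin n) ∈ S := by simp [hS]
  have hSne : S.Nonempty := ⟨_, hiS⟩
  have hcard : S.card = n - i := by
    have := Fin.card_Ici (⟨i, hin⟩ : Fin n)
    rw [← this]
    congr 1
    ext j
    simp [hS, Fin.le_def]
  obtain ⟨x, hx⟩ : ∃ x, π[i]? = some x := by
    rw [← Option.isSome_iff_exists]
    simp [hπ.length_eq, hin]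
  -- A key `x < i` already stands at position `x` of `π`, so it cannot also stand at position `i`.
  have hxS : x ∈ S := by
    simp only [hS, Finset.mem_filter, Finset.mem_univ, true_and]
    by_contra! hlt
    have h1 := hpre x (by omega)
    obtain ⟨p1, q1⟩ := List.getElem?_eq_some_iff.1 h1
    obtain ⟨p2, q2⟩ := List.getElem?_eq_some_iff.1 hx
    have := (hπ.1.getElem_inj_iff).1 (q1.trans q2.symm)
    omega
  have hsum := sum_updatedPheromones a b hπ hu hx S hxS
  rw [hcard, Nat.cast_sub hin.le] at hsum
  have hlist : ((List.finRange n).take (k + 1)).drop i =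
      ⟨i, hin⟩ :: ((List.finRange n).take (k + 1)).drop (i + 1) := by
    rw [List.drop_eq_getElem_cons (by simp; omega)]
    simp
  have hni : n - i = (n - (i + 1)) + 1 := by omega
  have herase : S.erase ⟨i, hin⟩ = Finset.univ.filter fun j : Fin n => i + 1 ≤ (j : ℕ) := by
    ext j
    simp only [hS, Finset.mem_erase, Finset.mem_filter, Finset.mem_univ, true_and, ne_eq,
      Fin.ext_iff]
    omega
  have hfac : (0 : ℝ) < 1 + ((n : ℝ) - 1 - i) * ratio a b :=
    levelCost_factor_pos (ratio_pos a b) hin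
  have hb' : (b : ℝ) + ((n : ℝ) - i - 1) * a = b * (1 + ((n : ℝ) - 1 - i) * ratio a b) := by
    unfold ratio
    field_simp
    ring
  have hw : (updatedPheromones a b π u ⟨i, hin⟩ : ℝ) = b * if i < k then 1 else ratio a b := by
    unfold updatedPheromones
    split_ifs with h1 h2 h2
    · simp
    · rw [usesEdge_iff hπ.1 hu hx] at h1
      have : i + 1 ≤ fpp π := by
        rw [le_fpp_iff _ (by omega)]
        intro j hj
        rcases Nat.lt_succ_iff_lt_or_eq.1 hj with h | h
        · exact hpre j (by omega)
        · rw [h, hx, ← h1]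
          exact congrArg some (Fin.ext h.symm)
      omega
    · rw [usesEdge_iff hπ.1 hu hx] at h1
      have := hpre ⟨i, hin⟩ h2
      rw [hx] at this
      exact absurd (Option.some.inj this).symm h1
    · unfold ratio
      field_simp
  rw [hni, hlist, walkFrom_cons_prefix _ _ _ hSne, nextKey_apply, if_pos hiS, hsum, herase, hb', hw,
    mul_div_mul_left _ _ hb.ne']

theorem walkFrom_updated_prefix {n : ℕ} (a b : PosReal) {π : Path n} (hπ : IsTour π) {k : ℕ}
    (hk : k < n) (hf : fpp π = k) (d i : ℕ) (hd : d + i = k) (u : Option (Fin n))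
    (hu : (none :: π.map some)[i]? = some u) :
    (walkFrom (updatedPheromones a b π) (n - i) u
        (Finset.univ.filter fun j : Fin n => i ≤ (j : ℕ))).toOuterMeasure
      {ρ | ((List.finRange n).take (k + 1)).drop i <+: ρ} =
      ENNReal.ofReal (1 / ratio a b *
        ∏ j ∈ Finset.Ico i (k + 1), (1 + ((n : ℝ) - 1 - j) * ratio a b))⁻¹ := by
  have hfac : (0 : ℝ) < 1 + ((n : ℝ) - 1 - i) * ratio a b :=
    levelCost_factor_pos (ratio_pos a b) (by omega)
  rw [walkFrom_updated_step a b hπ hk hf (by omega) hu]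
  have hr := ratio_pos a b
  induction d generalizing i u with
  | zero =>
    have hik : i = k := by omega
    subst hik
    have : {ρ : Path n | ((List.finRange n).take (i + 1)).drop (i + 1) <+: ρ} = Set.univ := by
      ext ρ
      simp [List.drop_eq_nil_of_le]
    rw [this, (PMF.toOuterMeasure_apply_eq_one_iff _ _).2 (Set.subset_univ _), mul_one]
    simp only [Nat.Ico_succ_singleton, Finset.prod_singleton]
    congr 1
    simp only [lt_irrefl, if_false]
    field_simp
  | succ d ih =>
    have hfac' : (0 : ℝ) < 1 + ((n : ℝ) - 1 - (i + 1 : ℕ)) * ratio a b :=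
      levelCost_factor_pos (ratio_pos a b) (by omega)
    have hu' : (none :: π.map some)[i + 1]? = some (some (⟨i, by omega⟩ : Fin n)) := by
      have := (le_fpp_iff π hk.le).1 hf.ge ⟨i, by omega⟩ (by simp; omega)
      simp at this
      simp [this]
    rw [walkFrom_updated_step a b hπ hk hf (by omega) hu',
      ih (i + 1) (by omega) _ hu' hfac', if_pos (by omega),
      ← ENNReal.ofReal_mul (by positivity)]
    congr 1
    rw [Finset.prod_eq_prod_Ico_succ_bot (by omega : i < k + 1)]
    rw [mul_inv, mul_inv, mul_inv]
    ring

theorem walk_improvement {n : ℕ} (a b : PosReal) {π : Path n} (hπ : IsTour π) {k : ℕ}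
    (hk : k < n) (hf : fpp π = k) :
    (walk (updatedPheromones a b π)).toOuterMeasure {ρ | k < fpp ρ} =
      ENNReal.ofReal (levelCost n (ratio a b) k)⁻¹ := by
  have h := walkFrom_updated_prefix a b hπ hk hf k 0 rfl none (by simp)
  rw [levelCost, Finset.range_eq_Ico, ← h]
  unfold walk
  congr 1
  · simp
  · ext ρ
    exact le_fpp_iff_prefix ρ hk

/-! ### Renaming the keys -/

theorem nextKey_map {n : ℕ} (σ : Equiv.Perm (Fin n)) (τ τ' : Pheromones n)
    (hτ : ∀ u v, τ' (u.map σ) (σ v) = τ u v) (u : Option (Fin n)) (S : Finset (Fin n))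
    (hS : S.Nonempty) (hS' : (S.map σ.toEmbedding).Nonempty) :
    (nextKey τ u S hS).map σ = nextKey τ' (u.map σ) (S.map σ.toEmbedding) hS' := by
  ext v
  obtain ⟨w, rfl⟩ := σ.surjective v
  rw [PMF.map_apply, tsum_eq_single w]
  · rw [if_pos rfl, nextKey_apply, nextKey_apply, Finset.sum_map]
    simp [hτ]
  · intro x hx
    rw [if_neg (fun h => hx (σ.injective h).symm)]

/-- The ant sees keys only through pheromones, so its walk is equivariant under renaming. -/
theorem walkFrom_map {n : ℕ} (σ : Equiv.Perm (Fin n)) (τ τ' : Pheromones n)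
    (hτ : ∀ u v, τ' (u.map σ) (σ v) = τ u v) (m : ℕ) (u : Option (Fin n)) (S : Finset (Fin n)) :
    (walkFrom τ m u S).map (List.map σ) = walkFrom τ' m (u.map σ) (S.map σ.toEmbedding) := by
  induction m generalizing u S with
  | zero => simp [walkFrom, PMF.pure_map]
  | succ m ih =>
    by_cases hS : S.Nonempty
    · have hS' : (S.map σ.toEmbedding).Nonempty := hS.map
      rw [walkFrom_succ _ _ _ hS, walkFrom_succ _ _ _ hS', ← nextKey_map σ τ τ' hτ u S hS hS',
        PMF.map_bind, PMF.bind_map]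
      congr 1
      funext v
      have : (S.map σ.toEmbedding).erase (σ v) = (S.erase v).map σ.toEmbedding := by
        ext w
        obtain ⟨x, rfl⟩ := σ.surjective w
        simp
      simp only [Function.comp_apply, this]
      rw [← Option.map_some, ← ih (some v) (S.erase v), PMF.map_comp, PMF.map_comp]
      rfl
    · have hS' : ¬ (S.map σ.toEmbedding).Nonempty := by simpa using hS
      rw [walkFrom, walkFrom, dif_neg hS, dif_neg hS', PMF.pure_map]
      rfl

theorem walk_map {n : ℕ} (σ : Equiv.Perm (Fin n)) (τ τ' : Pheromones n)
    (hτ : ∀ u v, τ' (u.map σ) (σ v) = τ u v) :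
    (walk τ).map (List.map σ) = walk τ' := by
  unfold walk
  rw [walkFrom_map σ τ τ' hτ]
  simp

theorem UsesEdge.map {n : ℕ} (σ : Equiv.Perm (Fin n)) {π : Path n} {u : Option (Fin n)}
    {v : Fin n} (h : UsesEdge π u v) : UsesEdge (π.map σ) (u.map σ) (σ v) := by
  have := List.IsInfix.map (Option.map σ) h
  simpa [UsesEdge, Function.comp_def] using this

theorem usesEdge_map_iff {n : ℕ} (σ : Equiv.Perm (Fin n)) (π : Path n) (u : Option (Fin n))
    (v : Fin n) : UsesEdge (π.map σ) (u.map σ) (σ v) ↔ UsesEdge π u v := by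
  refine ⟨fun h => ?_, UsesEdge.map σ⟩
  have := h.map σ.symm
  simpa [Function.comp_def] using this

theorem updatedPheromones_map {n : ℕ} (a b : PosReal) (σ : Equiv.Perm (Fin n)) (π : Path n)
    (u : Option (Fin n)) (v : Fin n) :
    updatedPheromones a b (π.map σ) (u.map σ) (σ v) = updatedPheromones a b π u v := by
  classical
  unfold updatedPheromones
  exact if_congr (usesEdge_map_iff σ π u v) rfl rfl

theorem initialLaw_map {n : ℕ} (a : PosReal) (σ : Equiv.Perm (Fin n)) :
    (initialLaw n a).map (List.map σ) = initialLaw n a :=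
  walk_map σ _ _ fun _ _ => rfl

/-- A renaming of keys that fixes the first `k` keys is not noticed before the value `k` is
reached. -/
theorem iteration_map {n : ℕ} (a b : PosReal) (σ : Equiv.Perm (Fin n)) {k : ℕ} (hk : k ≤ n)
    (hσ : ∀ i : Fin n, (i : ℕ) < k → σ i = i) {π : Path n} (hπ : fpp π < k) :
    (iteration a b π).map (List.map σ) = iteration a b (π.map σ) := by
  have hval : fpp (π.map σ) = fpp π := by
    have h1 := (le_fpp_map_iff σ hσ π (j := fpp π) hπ.le (by omega)).2 le_rfl
    have h2 := le_fpp_map_iff σ hσ π (j := fpp π + 1) hπ (by omega)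
    omega
  unfold iteration
  rw [← walk_map σ _ _ (updatedPheromones_map a b σ π), PMF.map_comp, PMF.map_comp]
  congr 1
  funext ρ
  -- The acceptance test only asks for a value of at least `fpp π + 1 ≤ k`, a range in which `σ`
  -- preserves values.
  have h : fpp π < fpp (ρ.map σ) ↔ fpp π < fpp ρ :=
    le_fpp_map_iff σ hσ ρ (j := fpp π + 1) hπ (by omega)
  simp only [Function.comp_apply, hval]
  by_cases hlt : fpp π < fpp ρ
  · rw [if_pos hlt, if_pos (h.2 hlt)]
  · rw [if_neg hlt, if_neg (fun h' => hlt (h.1 h'))]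

/-! ### One iteration -/

instance instDiscreteMeasurableSpacePath (n : ℕ) : DiscreteMeasurableSpace (Path n) :=
  ⟨fun _ => trivial⟩

theorem iterationKernel_apply (n : ℕ) (a b : PosReal) (π : Path n) :
    iterationKernel n a b π = (iteration a b π).toMeasure := rfl

theorem iterationKernel_isTour {n : ℕ} (a b : PosReal) {π : Path n} (hπ : IsTour π) :
    iterationKernel n a b π {ρ | ¬ IsTour ρ} = 0 := by
  rw [iterationKernel_apply, PMF.toMeasure_apply_eq_zero_iff _ (.of_discrete),
    Set.disjoint_left]
  intro ρ hρ
  rw [iteration, PMF.mem_support_map_iff] at hρ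
  obtain ⟨x, hx, rfl⟩ := hρ
  simp only [Set.mem_ofPred_eq, not_not]
  split_ifs
  · exact isTour_of_mem_support_walk _ hx
  · exact hπ

theorem iterationKernel_lt {n : ℕ} (a b : PosReal) (π : Path n) :
    iterationKernel n a b π {ρ | fpp ρ < fpp π} = 0 := by
  rw [iterationKernel_apply, PMF.toMeasure_apply_eq_zero_iff _ (.of_discrete),
    Set.disjoint_left]
  intro ρ hρ
  rw [iteration, PMF.mem_support_map_iff] at hρ
  obtain ⟨x, hx, rfl⟩ := hρ
  simp only [Set.mem_ofPred_eq, not_lt]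
  split_ifs with h
  · exact h.le
  · exact le_rfl

theorem iterationKernel_gt {n : ℕ} (a b : PosReal) {π : Path n} (hπ : IsTour π)
    (hk : fpp π < n) :
    iterationKernel n a b π {ρ | fpp π < fpp ρ} =
      ENNReal.ofReal (levelCost n (ratio a b) (fpp π))⁻¹ := by
  rw [iterationKernel_apply, PMF.toMeasure_apply_eq_toOuterMeasure, iteration,
    PMF.toOuterMeasure_map_apply, ← walk_improvement a b hπ hk rfl]
  congr 1
  ext ρ
  simp only [Set.mem_preimage, Set.mem_ofPred_eq]
  split_ifs with h <;> simp [h]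

/-- The additive form avoids truncated subtraction in `ℝ≥0∞`; the balance equations below keep it.
-/
theorem iterationKernel_eq_add_gt {n : ℕ} (a b : PosReal) {π : Path n} (hπ : IsTour π)
    (hk : fpp π < n) :
    iterationKernel n a b π {ρ | fpp ρ = fpp π} +
      ENNReal.ofReal (levelCost n (ratio a b) (fpp π))⁻¹ = 1 := by
  rw [← iterationKernel_gt a b hπ hk, ← MeasureTheory.measure_union]
  · have h0 := iterationKernel_lt a b π
    have := MeasureTheory.prob_compl_eq_one_iff (μ := iterationKernel n a b π)
      (s := {ρ | fpp ρ < fpp π}) .of_discrete |>.2 h0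
    rw [← this]
    congr 1
    ext ρ
    simp only [Set.mem_union, Set.mem_ofPred_eq, Set.mem_compl_iff]
    omega
  · rw [Set.disjoint_left]
    intro ρ h1 h2
    simp only [Set.mem_ofPred_eq] at h1 h2
    omega
  · exact .of_discrete

theorem iterationKernel_map {n : ℕ} (a b : PosReal) (σ : Equiv.Perm (Fin n)) {k : ℕ} (hk : k ≤ n)
    (hσ : ∀ i : Fin n, (i : ℕ) < k → σ i = i) {π : Path n} (hπ : fpp π < k) :
    (iterationKernel n a b π).map (List.map σ) = iterationKernel n a b (π.map σ) := by
  rw [iterationKernel_apply, iterationKernel_apply, ← iteration_map a b σ hk hσ hπ,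
    PMF.toMeasure_map (hf := Measurable.of_discrete)]

open MeasureTheory ProbabilityTheory

/-! ### The law of the best path after `N` iterations -/

instance instIsProbabilityMeasureProcessLaw (n : ℕ) (a b : PosReal) :
    IsProbabilityMeasure (processLaw n a b) := by
  unfold processLaw
  infer_instance

/-- The law of the best path after `N` iterations. -/
noncomputable def marginal (n : ℕ) (a b : PosReal) (N : ℕ) : Measure (Path n) :=
  (processLaw n a b).map (fun ω => ω N)

instance instIsProbabilityMeasureMarginal (n : ℕ) (a b : PosReal) (N : ℕ) :
    IsProbabilityMeasure (marginal n a b N) :=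
  Measure.isProbabilityMeasure_map (measurable_pi_apply N).aemeasurable

theorem marginal_zero (n : ℕ) (a b : PosReal) :
    marginal n a b 0 = (initialLaw n a).toMeasure := by
  have h : (fun ω : ℕ → Path n => ω 0) =
      (fun h : (i : Finset.Iic 0) → Path n => h ⟨0, by simp⟩) ∘ Preorder.frestrictLe 0 := rfl
  rw [marginal, h, ← Measure.map_map (measurable_pi_apply _) (by fun_prop), processLaw,
    Kernel.trajMeasure, Measure.map_comp _ _ (by fun_prop), Kernel.traj_map_frestrictLe,
    Kernel.partialTraj_self, Measure.id_comp,
    Measure.map_map (measurable_pi_apply _) (MeasurableEquiv.measurable _)]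
  exact Measure.map_id

/-- The Markov property: the transition kernel reads only the last coordinate of the history. -/
theorem lintegral_processLaw_pair (n : ℕ) (a b : PosReal) (N : ℕ)
    (F : Path n × Path n → ℝ≥0∞) :
    ∫⁻ ω, F (ω N, ω (N + 1)) ∂(processLaw n a b) =
      ∫⁻ π, ∫⁻ ρ, F (π, ρ) ∂(iterationKernel n a b π) ∂(marginal n a b N) := by
  have hF : Measurable F := .of_discrete
  set e : ((i : Finset.Iic N) → Path n) → Path n := fun h => h ⟨N, Finset.mem_Iic.2 le_rfl⟩
    with he
  have hem : Measurable e := measurable_pi_apply _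
  have h := Kernel.map_frestrictLe_trajMeasure_compProd_eq_map_trajMeasure
    (X := fun _ => Path n) (μ₀ := (initialLaw n a).toMeasure)
    (κ := fun k => (iterationKernel n a b).comap
      (fun h : (i : Finset.Iic k) → Path n => h ⟨k, Finset.mem_Iic.2 le_rfl⟩)
      (measurable_pi_apply _)) (a := N)
  have h' := congrArg (fun μ => ∫⁻ x, F (e x.1, x.2) ∂μ) h
  have hm : Measurable fun x : ((i : Finset.Iic N) → Path n) × Path n => F (e x.1, x.2) :=
    hF.comp ((hem.comp measurable_fst).prodMk measurable_snd)
  rw [Measure.lintegral_compProd hm, lintegral_map hm (by fun_prop),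
    lintegral_map hm.lintegral_kernel_prod_right' (by fun_prop)] at h'
  rw [marginal, lintegral_map .of_discrete (measurable_pi_apply N)]
  exact h'.symm

theorem lintegral_marginal_succ (n : ℕ) (a b : PosReal) (N : ℕ) (f : Path n → ℝ≥0∞) :
    ∫⁻ π, f π ∂(marginal n a b (N + 1)) =
      ∫⁻ π, ∫⁻ ρ, f ρ ∂(iterationKernel n a b π) ∂(marginal n a b N) := by
  rw [← lintegral_processLaw_pair n a b N (fun x => f x.2), marginal,
    lintegral_map .of_discrete (measurable_pi_apply _)]

theorem marginal_succ_apply (n : ℕ) (a b : PosReal) (N : ℕ) (B : Set (Path n)) :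
    marginal n a b (N + 1) B = ∫⁻ π, iterationKernel n a b π B ∂(marginal n a b N) := by
  rw [← lintegral_indicator_one .of_discrete, lintegral_marginal_succ]
  simp_rw [lintegral_indicator_one (MeasurableSet.of_discrete (s := B))]

theorem marginal_isTour (n : ℕ) (a b : PosReal) (N : ℕ) :
    ∀ᵐ π ∂(marginal n a b N), IsTour π := by
  rw [ae_iff]
  induction N with
  | zero =>
    rw [marginal_zero, PMF.toMeasure_apply_eq_zero_iff _ .of_discrete, Set.disjoint_left]
    intro ρ hρ
    simpa using isTour_of_mem_support_walk _ hρ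
  | succ N ih =>
    rw [marginal_succ_apply, lintegral_eq_zero_iff .of_discrete]
    filter_upwards [ae_iff.2 ih] with π hπ
    exact iterationKernel_isTour a b hπ

theorem processLaw_fpp_monotone (n : ℕ) (a b : PosReal) :
    ∀ᵐ ω ∂(processLaw n a b), Monotone fun N => fpp (ω N) := by
  have h : ∀ N, ∀ᵐ ω ∂(processLaw n a b), fpp (ω N) ≤ fpp (ω (N + 1)) := by
    intro N
    have hfpp : Measurable (fpp (n := n)) := .of_discrete
    have hs : MeasurableSet {ω : ℕ → Path n | fpp (ω (N + 1)) < fpp (ω N)} :=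
      measurableSet_lt (hfpp.comp (measurable_pi_apply (N + 1)))
        (hfpp.comp (measurable_pi_apply N))
    simp only [ae_iff, not_le]
    rw [← lintegral_indicator_one hs]
    have := lintegral_processLaw_pair n a b N ({x | fpp x.2 < fpp x.1}.indicator 1)
    refine Eq.trans this ?_
    rw [lintegral_eq_zero_iff .of_discrete]
    refine Eventually.of_forall fun π => ?_
    have := iterationKernel_lt a b π
    rwa [← lintegral_indicator_one .of_discrete] at this
  filter_upwards [ae_all_iff.2 h] with ω hω
  exact monotone_nat_of_le_succ hω

/-! ### Symmetry -/

theorem marginal_restrict_map {n : ℕ} (a b : PosReal) (σ : Equiv.Perm (Fin n)) {k : ℕ}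
    (hk : k ≤ n) (hσ : ∀ i : Fin n, (i : ℕ) < k → σ i = i) (N : ℕ) :
    ((marginal n a b N).restrict {π | fpp π < k}).map (List.map σ) =
      (marginal n a b N).restrict {π | fpp π < k} := by
  have hA : List.map σ ⁻¹' {π : Path n | fpp π < k} = {π | fpp π < k} := by
    ext π
    have := le_fpp_map_iff σ hσ π le_rfl hk
    simp only [Set.mem_preimage, Set.mem_ofPred_eq]
    omega
  induction N with
  | zero =>
    conv_rhs => rw [marginal_zero, ← initialLaw_map a σ,
      ← PMF.toMeasure_map (hf := Measurable.of_discrete), ← marginal_zero n a b]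
    rw [Measure.restrict_map .of_discrete .of_discrete, hA]
  | succ N ih =>
    -- Values never decrease, so mass below `k` comes only from mass below `k`, where the kernel
    -- commutes with `σ`.
    have key : ∀ B : Set (Path n), marginal n a b (N + 1) ({π | fpp π < k} ∩ B) =
        ∫⁻ π in {π | fpp π < k}, iterationKernel n a b π ({π | fpp π < k} ∩ B)
          ∂(marginal n a b N) := by
      intro B
      rw [marginal_succ_apply, ← lintegral_add_compl _ (A := {π | fpp π < k}) .of_discrete]
      convert add_zero _
      rw [setLIntegral_eq_zero_iff .of_discrete .of_discrete]
      refine Eventually.of_forall fun π hπ => ?_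
      refine measure_mono_null ?_ (iterationKernel_lt a b π)
      rintro ρ ⟨hρ, -⟩
      simp only [Set.mem_compl_iff, Set.mem_ofPred_eq] at hπ hρ ⊢
      omega
    ext B -
    rw [Measure.map_apply .of_discrete .of_discrete, Measure.restrict_apply .of_discrete,
      Measure.restrict_apply .of_discrete, Set.inter_comm, Set.inter_comm B, key, key]
    conv_rhs => rw [← ih, lintegral_map .of_discrete .of_discrete]
    refine setLIntegral_congr_fun .of_discrete fun π hπ => ?_
    rw [← iterationKernel_map a b σ hk hσ hπ, Measure.map_apply .of_discrete .of_discrete,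
      Set.preimage_inter, hA]

/-! ### Balance equations for one level -/

/-- The probability that iteration `N + 1` leaves the set of paths of value below `k` and leads
into `B`. -/
noncomputable def inflow (n : ℕ) (a b : PosReal) (k N : ℕ) (B : Set (Path n)) : ℝ≥0∞ :=
  ∫⁻ π in {π | fpp π < k}, iterationKernel n a b π B ∂(marginal n a b N)

theorem marginal_succ_ge (n : ℕ) (a b : PosReal) (k N : ℕ) :
    marginal n a b (N + 1) {π | k ≤ fpp π} =
      inflow n a b k N {π | k ≤ fpp π} + marginal n a b N {π | k ≤ fpp π} := by
  have hc : {π : Path n | fpp π < k}ᶜ = {π | k ≤ fpp π} := by ext; simp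
  rw [marginal_succ_apply, ← lintegral_add_compl _ (A := {π | fpp π < k}) .of_discrete, inflow, hc]
  congr 1
  rw [← setLIntegral_one]
  refine setLIntegral_congr_fun .of_discrete fun π hπ => ?_
  have := prob_compl_eq_one_iff (μ := iterationKernel n a b π)
      (s := {ρ | fpp ρ < fpp π}) .of_discrete |>.2 (iterationKernel_lt a b π)
  refine le_antisymm prob_le_one ?_
  rw [← this]
  refine measure_mono fun ρ hρ => ?_
  simp only [Set.mem_compl_iff, Set.mem_ofPred_eq] at hπ hρ ⊢
  omega

/-- Level `k` gains from below and loses the fraction `1 / levelCost` upwards; nothing returns from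
higher levels. -/
theorem marginal_succ_eq {n : ℕ} (a b : PosReal) {k : ℕ} (hk : k < n) (N : ℕ) :
    marginal n a b (N + 1) {π | fpp π = k} +
        ENNReal.ofReal (levelCost n (ratio a b) k)⁻¹ * marginal n a b N {π | fpp π = k} =
      inflow n a b k N {π | fpp π = k} + marginal n a b N {π | fpp π = k} := by
  rw [marginal_succ_apply, ← lintegral_add_compl _ (A := {π | fpp π < k}) .of_discrete, inflow,
    add_assoc]
  congr 1
  have hlevel : ∫⁻ π in {π | fpp π < k}ᶜ, iterationKernel n a b π {π | fpp π = k}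
      ∂(marginal n a b N) = ∫⁻ π in {π | fpp π = k}, iterationKernel n a b π {π | fpp π = k}
      ∂(marginal n a b N) := by
    rw [← lintegral_indicator .of_discrete, ← lintegral_indicator .of_discrete]
    congr 1
    ext π
    simp only [Set.indicator_apply, Set.mem_compl_iff, Set.mem_ofPred_eq, not_lt]
    rcases lt_trichotomy (fpp π) k with h | h | h
    · rw [if_neg (by omega), if_neg (by omega)]
    · rw [if_pos (by omega), if_pos (by omega)]
    · rw [if_pos (by omega), if_neg (by omega)]
      refine measure_mono_null (fun ρ hρ => ?_) (iterationKernel_lt a b π)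
      simp only [Set.mem_ofPred_eq] at hρ ⊢
      omega
  rw [hlevel, ← setLIntegral_one, ← lintegral_const_mul _ .of_discrete,
    ← lintegral_add_left .of_discrete]
  refine setLIntegral_congr_fun_ae .of_discrete ?_
  filter_upwards [marginal_isTour n a b N] with π hπ hπk
  change fpp π = k at hπk
  subst hπk
  rw [mul_one]
  exact iterationKernel_eq_add_gt a b hπ hk

/-- A symmetric measure gives at most as much mass to the values above `k` as to the value `k`. -/
theorem measure_gt_le_measure_eq {n k : ℕ} (hk : k + 1 < n) (μ : Set (Path n) → ℝ≥0∞)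
    (hmono : ∀ s t, s ⊆ t → μ s ≤ μ t)
    (hμ : ∀ σ : Equiv.Perm (Fin n), (∀ i : Fin n, (i : ℕ) < k → σ i = i) →
      μ (List.map σ ⁻¹' {π | k < fpp π}) = μ {π | k < fpp π}) :
    μ {π | k < fpp π} ≤ μ {π | fpp π = k} := by
  set x : Fin n := ⟨k, by omega⟩ with hx
  set y : Fin n := ⟨k + 1, hk⟩ with hy
  have hσ : ∀ i : Fin n, (i : ℕ) < k → Equiv.swap x y i = i := by
    intro i hi
    apply Equiv.swap_apply_of_ne_of_ne
    · rintro rfl; simp [hx] at hi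
    · rintro rfl; simp [hy] at hi
  rw [← hμ _ hσ]
  -- If the swapped path has value above `k`, then `π` has key `k + 1` at position `k`, so its value
  -- stops at `k`.
  refine hmono _ _ fun π hπ => ?_
  simp only [Set.mem_preimage, Set.mem_ofPred_eq] at hπ ⊢
  have h1 : k ≤ fpp π := (le_fpp_map_iff _ hσ π le_rfl (by omega)).1 hπ.le
  refine le_antisymm (not_lt.1 fun hlt => ?_) h1
  have e1 := (le_fpp_iff π (k := k + 1) (by omega)).1 hlt x (by simp [hx])
  have e2 := (le_fpp_iff _ (k := k + 1) (by omega)).1 hπ x (by simp [hx])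
  rw [List.getElem?_map, e1] at e2
  simp [hx, hy] at e2

theorem inflow_ge_le {n k : ℕ} (a b : PosReal) (hk : k + 1 < n) (N : ℕ) :
    inflow n a b k N {π | k ≤ fpp π} ≤ 2 * inflow n a b k N {π | fpp π = k} := by
  have hsymm : inflow n a b k N {π | k < fpp π} ≤ inflow n a b k N {π | fpp π = k} := by
    refine measure_gt_le_measure_eq hk (inflow n a b k N)
      (fun s t hst => lintegral_mono fun π => measure_mono hst) fun σ hσ => ?_
    unfold inflow
    conv_rhs => rw [← marginal_restrict_map a b σ (by omega : k ≤ n) hσ N,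
      lintegral_map .of_discrete .of_discrete]
    refine setLIntegral_congr_fun .of_discrete fun π hπ => ?_
    rw [← iterationKernel_map a b σ (by omega) hσ hπ, Measure.map_apply .of_discrete .of_discrete]
  rw [two_mul]
  refine le_trans ?_ (add_le_add_right hsymm _)
  unfold inflow
  rw [← lintegral_add_left .of_discrete]
  refine lintegral_mono fun π => (measure_mono fun ρ hρ => ?_).trans (measure_union_le _ _)
  simp only [Set.mem_union, Set.mem_ofPred_eq] at hρ ⊢
  omega

theorem marginal_zero_ge_le {n k : ℕ} (a b : PosReal) (hk : k + 1 < n) :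
    marginal n a b 0 {π | k ≤ fpp π} ≤ 2 * marginal n a b 0 {π | fpp π = k} := by
  have hsymm : marginal n a b 0 {π | k < fpp π} ≤ marginal n a b 0 {π | fpp π = k} := by
    refine measure_gt_le_measure_eq hk (marginal n a b 0)
      (fun s t hst => measure_mono hst) fun σ hσ => ?_
    rw [marginal_zero]
    conv_rhs => rw [← initialLaw_map a σ, ← PMF.toMeasure_map (hf := Measurable.of_discrete),
      Measure.map_apply .of_discrete .of_discrete]
  rw [two_mul]
  refine le_trans ?_ (add_le_add_right hsymm _)
  refine (measure_mono fun ρ hρ => ?_).trans (measure_union_le _ _)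
  simp only [Set.mem_union, Set.mem_ofPred_eq] at hρ ⊢
  omega

/-! ### The expected time spent on one level -/

/-- The expected number of iterations that start with a best path of value `k`. -/
noncomputable def levelTime (n : ℕ) (a b : PosReal) (k : ℕ) : ℝ≥0∞ :=
  ∑' N, marginal n a b N {π | fpp π = k}

/-- Summed balance: the mass now at `k` plus the mass that has left `k` is the mass that ever
arrived there. -/
theorem marginal_add_sum_le {n : ℕ} (a b : PosReal) {k : ℕ} (hk : k < n) (M : ℕ) :
    marginal n a b M {π | fpp π = k} + ENNReal.ofReal (levelCost n (ratio a b) k)⁻¹ *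
        ∑ N ∈ Finset.range M, marginal n a b N {π | fpp π = k} ≤
      marginal n a b M {π | k ≤ fpp π} := by
  induction M with
  | zero =>
    simp only [Finset.range_zero, Finset.sum_empty, mul_zero, add_zero]
    exact measure_mono fun π hπ => ge_of_eq hπ
  | succ M ih =>
    rw [Finset.sum_range_succ, mul_add, add_left_comm, marginal_succ_eq a b hk, marginal_succ_ge,
      add_left_comm, add_comm (ENNReal.ofReal _ * _)]
    refine add_le_add (lintegral_mono fun π => measure_mono fun ρ hρ => ge_of_eq hρ) ih

/-- By symmetry, at least half of the mass that first reaches value `k` or more lands exactly on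
`k`. -/
theorem marginal_le_add_sum {n : ℕ} (a b : PosReal) {k : ℕ} (hk : k + 1 < n) (M : ℕ) :
    marginal n a b M {π | k ≤ fpp π} ≤ 2 * (marginal n a b M {π | fpp π = k} +
      ENNReal.ofReal (levelCost n (ratio a b) k)⁻¹ *
        ∑ N ∈ Finset.range M, marginal n a b N {π | fpp π = k}) := by
  induction M with
  | zero =>
    simp only [Finset.range_zero, Finset.sum_empty, mul_zero, add_zero]
    exact marginal_zero_ge_le a b hk
  | succ M ih =>
    rw [Finset.sum_range_succ, mul_add (ENNReal.ofReal _), add_left_comm,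
      marginal_succ_eq a b (by omega), marginal_succ_ge,
      add_left_comm, add_comm (ENNReal.ofReal _ * _), mul_add]
    exact add_le_add (inflow_ge_le a b hk M) ih

theorem levelTime_le {n : ℕ} (a b : PosReal) {k : ℕ} (hk : k < n) :
    levelTime n a b k ≤ ENNReal.ofReal (levelCost n (ratio a b) k) := by
  have hpos := levelCost_pos (ratio_pos a b) hk
  have h : ENNReal.ofReal (levelCost n (ratio a b) k)⁻¹ * levelTime n a b k ≤ 1 := by
    rw [levelTime, ← ENNReal.tsum_mul_left]
    refine ENNReal.tsum_le_of_sum_range_le fun M => ?_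
    rw [← Finset.mul_sum]
    exact le_add_self.trans ((marginal_add_sum_le a b hk M).trans prob_le_one)
  rw [ENNReal.ofReal_inv_of_pos hpos] at h
  rw [mul_comm, ← div_eq_mul_inv] at h
  rw [ENNReal.div_le_iff (by simpa using hpos) ENNReal.ofReal_ne_top, one_mul] at h
  exact h

theorem tendsto_marginal_eq {n : ℕ} (a b : PosReal) {k : ℕ} (hk : k < n) :
    Tendsto (fun M => marginal n a b M {π | fpp π = k}) atTop (nhds 0) :=
  ENNReal.tendsto_atTop_zero_of_tsum_ne_top
    ((levelTime_le a b hk).trans_lt ENNReal.ofReal_lt_top).ne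

theorem sum_marginal_eq (n : ℕ) (a b : PosReal) (k N : ℕ) :
    ∑ j ∈ Finset.range k, marginal n a b N {π | fpp π = j} = marginal n a b N {π | fpp π < k} := by
  rw [← measure_biUnion_finset _ (fun _ _ => .of_discrete)]
  · congr 1
    ext π
    simp
  · intro i _ j _ hij
    rw [Function.onFun, Set.disjoint_left]
    intro π h1 h2
    exact hij (h1.symm.trans h2)

theorem le_levelTime {n : ℕ} (a b : PosReal) {k : ℕ} (hk : k + 1 < n) :
    ENNReal.ofReal (levelCost n (ratio a b) k / 2) ≤ levelTime n a b k := by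
  have hpos := levelCost_pos (ratio_pos a b) (by omega : k < n)
  set p := ENNReal.ofReal (levelCost n (ratio a b) k)⁻¹ with hp
  have h : ∀ M, 1 ≤ ∑ j ∈ Finset.range k, marginal n a b M {π | fpp π = j} +
      2 * (marginal n a b M {π | fpp π = k} + p * levelTime n a b k) := by
    intro M
    have h1 : marginal n a b M {π | fpp π < k} + marginal n a b M {π | k ≤ fpp π} = 1 := by
      have hc : {π : Path n | k ≤ fpp π} = {π | fpp π < k}ᶜ := by ext; simp
      rw [hc, prob_add_prob_compl .of_discrete]
    rw [← h1, sum_marginal_eq]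
    refine add_le_add le_rfl ((marginal_le_add_sum a b hk M).trans ?_)
    gcongr
    exact ENNReal.sum_le_tsum _
  -- As `M` grows, every level below `n` empties, leaving `1 ≤ 2 * (p * levelTime)`.
  have hlim : Tendsto (fun M => ∑ j ∈ Finset.range k, marginal n a b M {π | fpp π = j} +
      2 * (marginal n a b M {π | fpp π = k} + p * levelTime n a b k)) atTop
      (nhds (∑ j ∈ Finset.range k, 0 + 2 * (0 + p * levelTime n a b k))) := by
    refine Tendsto.add (tendsto_finsetSum _ fun j hj => tendsto_marginal_eq a b ?_)
      (ENNReal.Tendsto.const_mul ((tendsto_marginal_eq a b (by omega)).add_const _)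
        (Or.inr (by simp)))
    rw [Finset.mem_range] at hj
    omega
  have h2 := ge_of_tendsto' hlim h
  simp only [Finset.sum_const_zero, zero_add] at h2
  calc ENNReal.ofReal (levelCost n (ratio a b) k / 2)
      ≤ ENNReal.ofReal (levelCost n (ratio a b) k / 2) * (2 * (p * levelTime n a b k)) :=
        le_mul_of_one_le_right' h2
    _ = ENNReal.ofReal (levelCost n (ratio a b) k / 2 * 2 * (levelCost n (ratio a b) k)⁻¹) *
        levelTime n a b k := by
        rw [ENNReal.ofReal_mul (by positivity), ENNReal.ofReal_mul (by positivity), hp]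
        simp only [ENNReal.ofReal_ofNat]
        ring
    _ = levelTime n a b k := by
        rw [div_mul_cancel₀ _ two_ne_zero, mul_inv_cancel₀ hpos.ne']
        simp

/-! ### The expected optimization time -/

/-- By monotonicity the non-optimal times form an initial segment. If the optimum is never reached,
both sides are `∞`. -/
theorem optimizationTime_eq_tsum {n : ℕ} {ω : ℕ → Path n} (hω : Monotone fun N => fpp (ω N)) :
    optimizationTime ω = ∑' N, {π : Path n | fpp π < n}.indicator 1 (ω N) := by
  unfold optimizationTime
  by_cases h : ∃ N, fpp (ω N) = n
  · have hN := Nat.find_spec h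
    have hmin := fun m => Nat.find_min h (m := m)
    set N := Nat.find h
    rw [tsum_eq_sum (s := Finset.range N)]
    · rw [Finset.sum_congr rfl (g := fun _ => 1)]
      · simp only [Finset.sum_const, Finset.card_range, nsmul_eq_mul, mul_one]
        refine le_antisymm (iInf₂_le N hN) (le_iInf₂ fun k hk => ?_)
        exact_mod_cast not_lt.1 fun hlt => hmin k hlt hk
      · intro m hm
        rw [Finset.mem_range] at hm
        rw [Set.indicator_of_mem]
        · rfl
        · exact lt_of_le_of_ne (fpp_le _) (hmin m hm)
    · intro m hm
      rw [Finset.mem_range, not_lt] at hm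
      have := hω hm
      simp only [hN] at this
      simp [this]
  · push Not at h
    have h1 : ∀ N, {π : Path n | fpp π < n}.indicator (1 : Path n → ℝ≥0∞) (ω N) = 1 := by
      intro N
      rw [Set.indicator_of_mem]
      · rfl
      · exact lt_of_le_of_ne (fpp_le _) (h N)
    simp [h1, h]

theorem expectedTime_eq_sum (n : ℕ) (a b : PosReal) :
    expectedTime n a b = ∑ k ∈ Finset.range n, levelTime n a b k := by
  have h1 : expectedTime n a b = ∫⁻ ω, ∑' N, {π : Path n | fpp π < n}.indicator 1 (ω N)
      ∂(processLaw n a b) := by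
    refine lintegral_congr_ae ?_
    filter_upwards [processLaw_fpp_monotone n a b] with ω hω
    exact optimizationTime_eq_tsum hω
  have hf : Measurable ({π : Path n | fpp π < n}.indicator (1 : Path n → ℝ≥0∞)) := .of_discrete
  have h2 : ∫⁻ ω, ∑' N, {π : Path n | fpp π < n}.indicator (1 : Path n → ℝ≥0∞) (ω N)
      ∂(processLaw n a b) = ∑' N, ∫⁻ ω, {π : Path n | fpp π < n}.indicator (1 : Path n → ℝ≥0∞)
        (ω N) ∂(processLaw n a b) :=
    lintegral_tsum fun N => (hf.comp (measurable_pi_apply N)).aemeasurable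
  rw [h1, h2]
  simp only [levelTime]
  rw [← Summable.tsum_finsetSum fun _ _ => ENNReal.summable]
  refine tsum_congr fun N => ?_
  rw [sum_marginal_eq, ← lintegral_indicator_one .of_discrete, marginal,
    lintegral_map .of_discrete (measurable_pi_apply N)]

theorem expectedTime_le (n : ℕ) (a b : PosReal) :
    expectedTime n a b ≤
      ENNReal.ofReal (∑ k ∈ Finset.range n, levelCost n (ratio a b) k) := by
  rw [expectedTime_eq_sum, ENNReal.ofReal_sum_of_nonneg]
  · exact Finset.sum_le_sum fun k hk => levelTime_le a b (Finset.mem_range.1 hk)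
  · exact fun k hk => (levelCost_pos (ratio_pos a b) (Finset.mem_range.1 hk)).le

theorem expectedTime_ne_top (n : ℕ) (a b : PosReal) : expectedTime n a b ≠ ∞ :=
  ((expectedTime_le n a b).trans_lt ENNReal.ofReal_lt_top).ne

theorem T_nonneg (n : ℕ) (a b : PosReal) : 0 ≤ T n a b := ENNReal.toReal_nonneg

theorem T_le (n : ℕ) (a b : PosReal) :
    T n a b ≤ ∑ k ∈ Finset.range n, levelCost n (ratio a b) k :=
  ENNReal.toReal_le_of_le_ofReal
    (Finset.sum_nonneg fun _ hk => (levelCost_pos (ratio_pos a b) (Finset.mem_range.1 hk)).le)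
    (expectedTime_le n a b)

theorem le_T (n : ℕ) (a b : PosReal) :
    (∑ k ∈ Finset.range (n - 1), levelCost n (ratio a b) k) / 2 ≤ T n a b := by
  rw [T, ← ENNReal.ofReal_le_iff_le_toReal (expectedTime_ne_top n a b), expectedTime_eq_sum,
    Finset.sum_div, ENNReal.ofReal_sum_of_nonneg]
  · refine (Finset.sum_le_sum fun k hk => le_levelTime a b ?_).trans
      (Finset.sum_le_sum_of_subset (Finset.range_mono (Nat.sub_le n 1)))
    rw [Finset.mem_range] at hk
    omega
  · intro k hk
    rw [Finset.mem_range] at hk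
    exact (half_pos (levelCost_pos (ratio_pos a b) (by omega))).le

/-! ### Estimates of the level costs -/

theorem inv_le_levelCost {n k : ℕ} {t : ℝ} (ht : 0 < t) (hk : k < n) :
    1 / t ≤ levelCost n t k := by
  refine le_mul_of_one_le_right (by positivity) ?_
  refine (Finset.prod_const_one (s := Finset.range (k + 1))).symm.trans_le
    (Finset.prod_le_prod (fun _ _ => zero_le_one) fun j hj => ?_)
  have : (j : ℝ) + 1 ≤ n := by exact_mod_cast (Finset.mem_range.1 hj).trans_le hk
  have : 0 ≤ ((n : ℝ) - 1 - j) * t := mul_nonneg (by linarith) ht.le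
  linarith

theorem mul_le_levelCost {n k : ℕ} {t : ℝ} (ht : 0 < t) (hk : k < n) :
    ((k : ℝ) + 1) * ((n : ℝ) - 1 - k) ≤ levelCost n t k := by
  have hkn : (k : ℝ) + 1 ≤ n := by exact_mod_cast hk
  have hx : 0 ≤ ((n : ℝ) - 1 - k) * t := mul_nonneg (by linarith) ht.le
  have h1 : (1 + ((n : ℝ) - 1 - k) * t) ^ (k + 1) ≤
      ∏ j ∈ Finset.range (k + 1), (1 + ((n : ℝ) - 1 - j) * t) := by
    rw [← Finset.card_range (k + 1), ← Finset.prod_const, Finset.card_range]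
    refine Finset.prod_le_prod (fun _ _ => by linarith) fun j hj => ?_
    have : (j : ℝ) ≤ k := by exact_mod_cast Finset.mem_range_succ_iff.1 hj
    gcongr
  -- Bernoulli: the linear term contains a factor `t` that cancels `1 / t`, which makes the bound
  -- uniform in `t`.
  have h2 := one_add_mul_le_pow (a := ((n : ℝ) - 1 - k) * t) (by linarith) (k + 1)
  push_cast at h2
  rw [levelCost, one_div, ← div_eq_inv_mul, le_div_iff₀ ht]
  linarith

theorem levelCost_le {n k : ℕ} {t : ℝ} (ht : 0 < t) (hk : k < n) :
    levelCost n t k ≤ 1 / t * Real.exp (t * (n : ℝ) ^ 2) := by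
  refine mul_le_mul_of_nonneg_left ?_ (by positivity)
  have hkn : (k : ℝ) + 1 ≤ n := by exact_mod_cast hk
  calc ∏ j ∈ Finset.range (k + 1), (1 + ((n : ℝ) - 1 - j) * t)
      ≤ ∏ _j ∈ Finset.range (k + 1), Real.exp (n * t) := by
        refine Finset.prod_le_prod (fun j hj => ?_) fun j hj => ?_
        · exact (levelCost_factor_pos ht ((Finset.mem_range.1 hj).trans_le hk)).le
        · have h1 : ((n : ℝ) - 1 - j) * t ≤ n * t := by
            have : (0 : ℝ) ≤ j := Nat.cast_nonneg j
            gcongr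
            linarith
          have h2 := Real.add_one_le_exp (n * t)
          linarith
    _ = Real.exp ((k + 1) * (n * t)) := by
        rw [Finset.prod_const, Finset.card_range, ← Real.exp_nat_mul]
        push_cast
        rfl
    _ ≤ Real.exp (t * (n : ℝ) ^ 2) := by
        rw [Real.exp_le_exp]
        have : ((k : ℝ) + 1) * (n * t) ≤ n * (n * t) := by gcongr
        linarith

/-- The product is a falling factorial. The power of `1` is kept to match the partial sums of the
exponential series. -/
theorem levelCost_one {n k : ℕ} (hk : k < n) :
    levelCost n 1 k = (n.factorial : ℝ) * (1 ^ (n - 1 - k) / ((n - 1 - k).factorial : ℝ)) := by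
  have h1 : ∏ j ∈ Finset.range (k + 1), (1 + ((n : ℝ) - 1 - j) * 1) =
      (n.descFactorial (k + 1) : ℝ) := by
    rw [Nat.descFactorial_eq_prod_range, Nat.cast_prod]
    refine Finset.prod_congr rfl fun j hj => ?_
    rw [Finset.mem_range] at hj
    rw [Nat.cast_sub (by omega)]
    ring
  have h2 : ((n - 1 - k).factorial : ℝ) * (n.descFactorial (k + 1) : ℝ) = n.factorial := by
    have := Nat.factorial_mul_descFactorial (show k + 1 ≤ n from hk)
    rw [show n - (k + 1) = n - 1 - k by omega] at this
    exact_mod_cast this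
  have h3 : ((n - 1 - k).factorial : ℝ) ≠ 0 := Nat.cast_ne_zero.2 (Nat.factorial_ne_zero _)
  rw [levelCost, h1, ← h2, one_pow]
  field_simp

/-! ### Estimates of the expected optimization time -/

theorem T_le_exp (n : ℕ) (a b : PosReal) :
    T n a b ≤ n / ratio a b * Real.exp (ratio a b * (n : ℝ) ^ 2) := by
  refine (T_le n a b).trans ((Finset.sum_le_sum fun k hk =>
    levelCost_le (ratio_pos a b) (Finset.mem_range.1 hk)).trans_eq ?_)
  rw [Finset.sum_const, Finset.card_range, nsmul_eq_mul]
  ring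

theorem div_le_T {n : ℕ} (hn : 2 ≤ n) (a b : PosReal) : n / ratio a b ≤ 4 * T n a b := by
  have hr := ratio_pos a b
  have h1 : ((n - 1 : ℕ) : ℝ) * (1 / ratio a b) ≤
      ∑ k ∈ Finset.range (n - 1), levelCost n (ratio a b) k := by
    rw [← nsmul_eq_mul, ← Finset.card_range (n - 1), ← Finset.sum_const, Finset.card_range]
    refine Finset.sum_le_sum fun k hk => inv_le_levelCost hr ?_
    rw [Finset.mem_range] at hk
    omega
  have h2 := le_T n a b
  have h3 : (n : ℝ) ≤ 2 * (n - 1 : ℕ) := by exact_mod_cast (by omega : n ≤ 2 * (n - 1))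
  have h4 : (n : ℝ) / ratio a b ≤ 2 * (n - 1 : ℕ) * (1 / ratio a b) := by
    rw [div_eq_mul_one_div]
    gcongr
  linarith

theorem cubic_le_T {n : ℕ} (hn : 8 ≤ n) (a b : PosReal) : 1 / 256 * (n : ℝ) ^ 3 ≤ T n a b := by
  have hr := ratio_pos a b
  -- For `m ≤ k < 2 * m` both `k + 1 ≥ m` and `n - 1 - k ≥ n / 2`. With `m ≥ n / 8` these levels
  -- cost at least `n ^ 3 / 128`, and `le_T` halves this.
  obtain ⟨m, hm⟩ : ∃ m, m = n / 4 := ⟨_, rfl⟩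
  have hm1 : (n : ℝ) ≤ 8 * m := by exact_mod_cast (by omega : n ≤ 8 * m)
  have hm2 : 4 * (m : ℝ) ≤ n := by exact_mod_cast (by omega : 4 * m ≤ n)
  have hn0 : (0 : ℝ) ≤ n := Nat.cast_nonneg n
  have h1 : (m : ℝ) * ((m : ℝ) * (n / 2)) ≤
      ∑ k ∈ Finset.range (n - 1), levelCost n (ratio a b) k := by
    calc (m : ℝ) * ((m : ℝ) * (n / 2))
        = ∑ _k ∈ Finset.Ico m (2 * m), (m : ℝ) * (n / 2) := by
          rw [Finset.sum_const, Nat.card_Ico, nsmul_eq_mul, show 2 * m - m = m by omega]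
      _ ≤ ∑ k ∈ Finset.Ico m (2 * m), levelCost n (ratio a b) k := by
          refine Finset.sum_le_sum fun k hk => ?_
          rw [Finset.mem_Ico] at hk
          refine le_trans ?_ (mul_le_levelCost hr (by omega))
          have h1 : (m : ℝ) ≤ k := by exact_mod_cast hk.1
          have h2 : (k : ℝ) + 1 ≤ 2 * m := by exact_mod_cast hk.2
          gcongr <;> linarith
      _ ≤ _ := by
          refine Finset.sum_le_sum_of_subset_of_nonneg ?_ fun k hk _ => ?_
          · intro k hk
            rw [Finset.mem_Ico] at hk
            rw [Finset.mem_range]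
            omega
          · rw [Finset.mem_range] at hk
            exact (levelCost_pos hr (by omega)).le
  have h2 := le_T n a b
  have h3 : (n : ℝ) / 8 * ((n : ℝ) / 8 * (n / 2)) ≤ (m : ℝ) * ((m : ℝ) * (n / 2)) := by
    gcongr <;> linarith
  nlinarith

theorem T_le_factorial (n : ℕ) {a b : PosReal} (h : ratio a b = 1) :
    T n a b ≤ Real.exp 1 * n.factorial := by
  refine (T_le n a b).trans ?_
  rw [h, Finset.sum_congr rfl fun k hk => levelCost_one (Finset.mem_range.1 hk), ← Finset.mul_sum,
    Finset.sum_range_reflect (fun i => (1 : ℝ) ^ i / (i.factorial : ℝ)) n, mul_comm]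
  exact mul_le_mul_of_nonneg_right (Real.sum_le_exp_of_nonneg zero_le_one n) (Nat.cast_nonneg _)

theorem factorial_le_T {n : ℕ} (hn : 2 ≤ n) {a b : PosReal} (h : ratio a b = 1) :
    (n.factorial : ℝ) ≤ 2 * T n a b := by
  have h1 := le_T n a b
  -- The last level available in `le_T` alone costs `n! / 1!`.
  have h2 : levelCost n (ratio a b) (n - 2) ≤
      ∑ k ∈ Finset.range (n - 1), levelCost n (ratio a b) k := by
    refine Finset.single_le_sum (fun k hk => ?_) (Finset.mem_range.2 (by omega))
    rw [Finset.mem_range] at hk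
    exact (levelCost_pos (ratio_pos a b) (by omega)).le
  rw [h, levelCost_one (by omega), show n - 1 - (n - 2) = 1 by omega] at h2
  simp only [one_pow, Nat.factorial_one, Nat.cast_one, div_one, mul_one] at h2
  rw [h] at h1
  linarith

/-! ### Asymptotics -/

theorem T_isTheta_of_isBigO (a b : ℕ → PosReal)
    (h : (fun n : ℕ => ratio (a n) (b n)) =O[atTop] (fun n : ℕ => 1 / (n : ℝ) ^ 2)) :
    (fun n : ℕ => T n (a n) (b n)) =Θ[atTop] (fun n : ℕ => (n : ℝ) / ratio (a n) (b n)) := by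
  constructor
  · obtain ⟨C, hC⟩ := h.bound
    -- Here `C` bounds `t * n ^ 2`, hence the exponential factor in `T_le_exp` is at most `exp C`.
    refine IsBigO.of_bound (Real.exp C) ?_
    filter_upwards [hC, eventually_gt_atTop 0] with n hn hn0
    have hr := ratio_pos (a n) (b n)
    have hn' : (0 : ℝ) < n := Nat.cast_pos.2 hn0
    rw [Real.norm_of_nonneg hr.le, Real.norm_of_nonneg (by positivity), mul_one_div,
      le_div_iff₀ (by positivity)] at hn
    rw [Real.norm_of_nonneg (T_nonneg _ _ _), Real.norm_of_nonneg (by positivity), mul_comm]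
    refine (T_le_exp n (a n) (b n)).trans ?_
    gcongr
  · refine IsBigO.of_bound 4 ?_
    filter_upwards [eventually_ge_atTop 2] with n hn
    have hr := ratio_pos (a n) (b n)
    rw [Real.norm_of_nonneg (T_nonneg _ _ _), Real.norm_of_nonneg (by positivity)]
    exact div_le_T hn _ _

theorem div_div_rpow {n : ℕ} (hn : 0 < n) (c s : ℝ) :
    (n : ℝ) / (c / (n : ℝ) ^ s) = c⁻¹ * (n : ℝ) ^ (s + 1) := by
  have hn' : (0 : ℝ) < n := Nat.cast_pos.2 hn
  rw [Real.rpow_add hn', Real.rpow_one, div_div_eq_mul_div]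
  ring

theorem T_isTheta_rpow (a b : ℕ → PosReal) {c s : ℝ} (hc : 0 < c) (hs : 2 ≤ s)
    (h : ∀ᶠ n : ℕ in atTop, ratio (a n) (b n) = c / (n : ℝ) ^ s) :
    (fun n : ℕ => T n (a n) (b n)) =Θ[atTop] (fun n : ℕ => (n : ℝ) ^ (s + 1)) := by
  have hO : (fun n : ℕ => ratio (a n) (b n)) =O[atTop] (fun n : ℕ => 1 / (n : ℝ) ^ 2) := by
    refine IsBigO.of_bound c ?_
    filter_upwards [h, eventually_ge_atTop 1] with n hn hn1
    have hn' : (1 : ℝ) ≤ n := Nat.one_le_cast.2 hn1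
    have hpow : (n : ℝ) ^ 2 ≤ (n : ℝ) ^ s := by
      rw [← Real.rpow_natCast]
      exact Real.rpow_le_rpow_of_exponent_le hn' (by exact_mod_cast hs)
    rw [hn, Real.norm_of_nonneg (by positivity), Real.norm_of_nonneg (by positivity), mul_one_div]
    gcongr
  refine (T_isTheta_of_isBigO a b hO).trans ?_
  have heq : (fun n : ℕ => (n : ℝ) / ratio (a n) (b n)) =ᶠ[atTop]
      fun n : ℕ => c⁻¹ * (n : ℝ) ^ (s + 1) := by
    filter_upwards [h, eventually_gt_atTop 0] with n hn hn0
    rw [hn, div_div_rpow hn0]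
  exact heq.isTheta.trans ((isTheta_refl _ _).const_mul_left (inv_ne_zero hc.ne'))

theorem T_isBigO_exp (a b : ℕ → PosReal) {c s : ℝ}
    (h : ∀ᶠ n : ℕ in atTop, ratio (a n) (b n) = c / (n : ℝ) ^ s) :
    (fun n : ℕ => T n (a n) (b n)) =O[atTop]
      (fun n : ℕ => (n : ℝ) ^ (s + 1) * Real.exp (c * (n : ℝ) ^ (2 - s))) := by
  refine IsBigO.of_bound c⁻¹ ?_
  filter_upwards [h, eventually_gt_atTop 0] with n hn hn0
  have hn' : (0 : ℝ) < n := Nat.cast_pos.2 hn0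
  have h1 := T_le_exp n (a n) (b n)
  have h2 : c / (n : ℝ) ^ s * (n : ℝ) ^ 2 = c * (n : ℝ) ^ (2 - s) := by
    rw [Real.rpow_sub hn', Real.rpow_ofNat]
    ring
  rw [hn, div_div_rpow hn0, h2, mul_assoc] at h1
  rwa [Real.norm_of_nonneg (T_nonneg _ _ _), Real.norm_of_nonneg (by positivity)]

theorem T_isTheta_factorial (a b : ℕ → PosReal)
    (h : ∀ᶠ n : ℕ in atTop, ratio (a n) (b n) = 1) :
    (fun n : ℕ => T n (a n) (b n)) =Θ[atTop] (fun n : ℕ => (n.factorial : ℝ)) := by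
  constructor
  · refine IsBigO.of_bound (Real.exp 1) ?_
    filter_upwards [h] with n hn
    rw [Real.norm_of_nonneg (T_nonneg _ _ _), Real.norm_of_nonneg (by positivity)]
    exact T_le_factorial n hn
  · refine IsBigO.of_bound 2 ?_
    filter_upwards [h, eventually_ge_atTop 2] with n hn hn2
    rw [Real.norm_of_nonneg (T_nonneg _ _ _), Real.norm_of_nonneg (by positivity)]
    exact factorial_le_T hn2 hn

end BACO

theorem mainTheorem1 :
    -- the expected optimization time is finite
    (∀ (n : ℕ) (τmin τmax : BACO.PosReal), BACO.expectedTime n τmin τmax ≠ ∞) ∧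
    -- cubic lower bound, uniformly in the pheromone ratio
    (∃ C : ℝ, 0 < C ∧ ∃ N : ℕ, ∀ n : ℕ, N ≤ n → ∀ τmin τmax : BACO.PosReal,
      C * (n : ℝ) ^ 3 ≤ BACO.T n τmin τmax) ∧
    -- from here on the pheromone levels are arbitrary functions of `n`
    (∀ τmin τmax : ℕ → BACO.PosReal,
      -- ratio in `O(1 / n ^ 2)`
      ((fun n : ℕ => BACO.ratio (τmin n) (τmax n)) =O[atTop] (fun n : ℕ => 1 / (n : ℝ) ^ 2) →
        (fun n : ℕ => BACO.T n (τmin n) (τmax n)) =Θ[atTop]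
          (fun n : ℕ => (n : ℝ) / BACO.ratio (τmin n) (τmax n))) ∧
      -- ratio `c / n ^ s` with `s ≥ 2`
      (∀ c s : ℝ, 0 < c → 2 ≤ s →
        (∀ᶠ n : ℕ in atTop, BACO.ratio (τmin n) (τmax n) = c / (n : ℝ) ^ s) →
        (fun n : ℕ => BACO.T n (τmin n) (τmax n)) =Θ[atTop]
          (fun n : ℕ => (n : ℝ) ^ (s + 1))) ∧
      -- ratio `c / n ^ 2`
      (∀ c : ℝ, 0 < c →
        (∀ᶠ n : ℕ in atTop, BACO.ratio (τmin n) (τmax n) = c / (n : ℝ) ^ 2) →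
        (fun n : ℕ => BACO.T n (τmin n) (τmax n)) =Θ[atTop] (fun n : ℕ => (n : ℝ) ^ 3)) ∧
      -- ratio `c / n ^ s` with `s < 2`
      (∀ c s : ℝ, 0 < c → s < 2 →
        (∀ᶠ n : ℕ in atTop, BACO.ratio (τmin n) (τmax n) = c / (n : ℝ) ^ s) →
        (fun n : ℕ => BACO.T n (τmin n) (τmax n)) =O[atTop]
          (fun n : ℕ => (n : ℝ) ^ (s + 1) * Real.exp (c * (n : ℝ) ^ (2 - s)))) ∧
      -- ratio `1` (blind search)
      ((∀ᶠ n : ℕ in atTop, BACO.ratio (τmin n) (τmax n) = 1) →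
        (fun n : ℕ => BACO.T n (τmin n) (τmax n)) =Θ[atTop]
          (fun n : ℕ => (n.factorial : ℝ)))) := by
  refine ⟨BACO.expectedTime_ne_top, ⟨1 / 256, by norm_num, 8, fun n hn a b =>
    BACO.cubic_le_T hn a b⟩, fun a b => ⟨BACO.T_isTheta_of_isBigO a b,
    fun c s hc hs h => BACO.T_isTheta_rpow a b hc hs h, fun c hc h => ?_,
    fun c s _ _ h => BACO.T_isBigO_exp a b h, BACO.T_isTheta_factorial a b⟩⟩
  have h2 := BACO.T_isTheta_rpow a b hc le_rfl (h.mono fun n hn => by rw [hn, Real.rpow_ofNat])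
  have h3 : ∀ n : ℕ, (n : ℝ) ^ ((2 : ℝ) + 1) = (n : ℝ) ^ 3 := fun n => by
    rw [show (2 : ℝ) + 1 = ((3 : ℕ) : ℝ) by norm_num, Real.rpow_natCast]
  simpa only [h3] using h2
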